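/- Let $\lambda_p>0$, $\sigma>0$, $\alpha>2$, $P_d>0$. Let $\Phi_p$ be a homogeneous Poisson point process (PPP) of density $\lambda_p$ in $\mathbb{R}^2$, whose points are the cluster centers. Each center $x\in\Phi_p$ has one active transmitter, at $x+y_x$, where the displacements $y_x$ are i.i.d. with density $\frac{1}{2\pi\sigma^2}e^{-\|y\|^2/(2\sigma^2)}$, and its channel to the origin has a gain $g_x$, where the $g_x$ are i.i.d. exponential random variables of mean $1$; centers, displacements and gains are independent. Given that there is a cluster center at $x_0$ (the representative cluster), the inter-cluster interference at the origin is $$I_{\Phi_p^{!}}=\sum_{x\in\Phi_p\setminus\{x_0\}}P_d\,g_x\,\|x+y_x\|^{-\alpha}.$$ This sum converges almost surely, and for every $s\ge 0$ and almost every $x_0\in\mathbb{R}^2$ its Laplace transform $\mathscr{L}_{I_{\Phi_p^{!}}}(s)=\mathbb{E}[e^{-sI_{\Phi_p^{!}}}]$, where the expectation is conditional on $x_0\in\Phi_p$ (Palm expectation), is $$\mathscr{L}_{I_{\Phi_p^{!}}}(s)=\exp\Big(-\pi\lambda_p\,(sP_d)^{2/\alpha}\,\Gamma(1+2/\alpha)\,\Gamma(1-2/\alpha)\Big).$$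 The unconditional Laplace transform of the interference $\sum_{x\in\Phi_p}P_d\,g_x\,\|x+y_x\|^{-\alpha}$ from all the clusters is the same, and so is that of the interference $\sum_{x\in\Phi_p}P_d\,g_x\,\|x\|^{-\alpha}$ (also almost surely convergent) when the transmitters are the points of the PPP themselves. -/

import Mathlib

open MeasureTheory ProbabilityTheory
open scoped ENNReal

namespace D2D

/-- The Euclidean plane. -/
abbrev Plane : Type := EuclideanSpace ℝ (Fin 2)

/-- The random counting measure `∑ i, δ_{X i}` of an enumerated point process `X`. -/
noncomputable def countingMeasure {Ω : Type*} (X : ℕ → Ω → Plane) (ω : Ω) : Measure Plane :=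
  Measure.sum fun i => Measure.dirac (X i ω)

/-- The intensity (mean) measure `B ↦ E[#{i | X i ∈ B}]` of an enumerated point process. -/
noncomputable def intensityMeasure {Ω : Type*} [MeasurableSpace Ω] (X : ℕ → Ω → Plane)
    (P : Measure Ω) : Measure Plane :=
  Measure.sum fun i => P.map (X i)

/-- The points `X 0, X 1, …` (listed in any order) form a homogeneous Poisson point process of
density `lam` in the plane: the number of points in a Borel set `B` of finite area is Poisson with
mean `lam * |B|`, and the numbers of points in disjoint sets are independent.
(For `lam > 0` such a process has almost surely infinitely many points, so that listing them
by the natural numbers is no restriction.) -/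
structure IsPoissonPointProcess {Ω : Type*} [MeasurableSpace Ω] (lam : ℝ)
    (X : ℕ → Ω → Plane) (P : Measure Ω) : Prop where
  measurable : ∀ i, Measurable (X i)
  hasLaw_count : ∀ B : Set Plane, MeasurableSet B → volume B ≠ ∞ →
    HasLaw (fun ω => countingMeasure X ω B)
      ((poissonMeasure (lam * volume.real B).toNNReal).map (fun k : ℕ => (k : ℝ≥0∞))) P
  indep_count : ∀ (n : ℕ) (B : Fin n → Set Plane), (∀ k, MeasurableSet (B k)) →
    (∀ k, volume (B k) ≠ ∞) → Pairwise (fun k l => Disjoint (B k) (B l)) →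
    iIndepFun (fun k ω => countingMeasure X ω (B k)) P

/-- The law on the plane with density `(2πσ²)⁻¹ exp (-‖y‖² / (2σ²))`. -/
noncomputable def gaussianDisplacement (σ : ℝ) : Measure Plane :=
  volume.withDensity fun y =>
    ENNReal.ofReal (1 / (2 * Real.pi * σ ^ 2) * Real.exp (-‖y‖ ^ 2 / (2 * σ ^ 2)))

/-- Cluster centres `X i` form a Poisson process of density `lam`; the cluster with centre `X i`
has one active transmitter, at `X i + Y i`, whose channel to the origin has fading gain `g i`.
The displacements `Y i` are i.i.d. Gaussian, the gains `g i` are i.i.d. exponential of mean one,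
and centres, displacements and gains are independent of each other. -/
structure IsClusterNetwork {Ω : Type*} [MeasurableSpace Ω] (lam σ : ℝ)
    (X Y : ℕ → Ω → Plane) (g : ℕ → Ω → ℝ) (P : Measure Ω) : Prop where
  parents : IsPoissonPointProcess lam X P
  measurable_displacement : ∀ i, Measurable (Y i)
  hasLaw_displacement : ∀ i, HasLaw (Y i) (gaussianDisplacement σ) P
  indep_displacement : iIndepFun Y P
  measurable_fading : ∀ i, Measurable (g i)
  hasLaw_fading : ∀ i, HasLaw (g i) (expMeasure 1) P
  indep_fading : iIndepFun g P
  indep_displacement_fading : IndepFun (fun ω i => Y i ω) (fun ω i => g i ω) P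
  indep_parents_marks : IndepFun (fun ω i => X i ω) (fun ω i => (Y i ω, g i ω)) P

/-- Power received at the origin from transmitter `i`, located at `T i`. -/
noncomputable def receivedPower {Ω : Type*} (α Pd : ℝ) (T : ℕ → Ω → Plane) (g : ℕ → Ω → ℝ)
    (i : ℕ) (ω : Ω) : ℝ :=
  Pd * g i ω * ‖T i ω‖ ^ (-α)

/-- Total power received at the origin from the transmitters with index in `S`. -/
noncomputable def interference {Ω : Type*} (α Pd : ℝ) (T : ℕ → Ω → Plane) (g : ℕ → Ω → ℝ)
    (S : Set ℕ) (ω : Ω) : ℝ :=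
  ∑' i : S, receivedPower α Pd T g i ω

/-- `L x₀` is the Palm (conditional) expectation, given that there is a point of the process at
`x₀`, of the quantity `F`, where `F i` is its value when the `i`-th point is the
distinguished one: `E[∑_{i : X i ∈ B} F i] = ∫_B L dΛ` for every Borel set `B`,
with `Λ` the intensity measure. When `Λ` is σ-finite, and the left side is too as a measure in
`B`, this determines `L` up to a `Λ`-null set. -/
structure IsPalmExpectation {Ω : Type*} [MeasurableSpace Ω] (X : ℕ → Ω → Plane)
    (P : Measure Ω) (F : ℕ → Ω → ℝ≥0∞) (L : Plane → ℝ≥0∞) : Prop where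
  measurable : Measurable L
  disintegration : ∀ B : Set Plane, MeasurableSet B →
    ∑' i, ∫⁻ ω in X i ⁻¹' B, F i ω ∂P = ∫⁻ x in B, L x ∂(intensityMeasure X P)

/-- The function `exp (-π lam (s Pd)^(2/α) Γ(1 + 2/α) Γ(1 - 2/α))`. -/
noncomputable def laplaceFormula (lam α Pd s : ℝ) : ℝ :=
  Real.exp (-(Real.pi * lam * (s * Pd) ^ (2 / α) *
    Real.Gamma (1 + 2 / α) * Real.Gamma (1 - 2 / α)))

end D2D

/-! Given the centres, averaging over the independent marks turns `exp (-s I)` into a product over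
the centres `x` of `v x`, the mean of `exp (-s Pd g ‖x + y‖ ^ (-α))` over one mark. The Laplace
functional of the Poisson process then gives `exp (-lam ∫ (1 - v))`. That functional comes from
simple functions, where independent Poisson counts on disjoint sets give a finite product
(`lintegral_expNeg_tsum`).

In `∫ (1 - v)` the mean over the displacement can be taken outside. Lebesgue measure is translation
invariant, so the displacement disappears; this is why the clustered and unclustered interferences
agree. What remains is `∫ (1 - exp (-c ‖z‖ ^ (-α))) dz = π c ^ (2/α) Γ(1 - 2/α)`, with the fading
moment `E[g ^ (2/α)] = Γ(1 + 2/α)`.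

The Palm statement is Slivnyak's theorem for exponential functionals. Differentiating the Laplace
functional at `h` in a direction `f` gives a Mecke formula (`lintegral_expNeg_tsum_mul_tsum`); the
choice `f = 1_B exp h` removes the factor of the distinguished point.

All computations take place in `[0, ∞]`, where sums and integrals always exist. Almost sure
convergence follows by letting `s → 0` in the transform, and only then are real-valued sums
introduced. -/

section
-- Laplace functional of the Poisson process
namespace D2D

/-- The map `a ↦ exp (-a)` on extended nonnegative reals. -/
noncomputable def expNeg (a : ℝ≥0∞) : ℝ≥0∞ := EReal.exp (-(a : EReal))

@[simp] lemma expNeg_zero : expNeg 0 = 1 := by simp [expNeg]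

@[simp] lemma expNeg_top : expNeg ∞ = 0 := by simp [expNeg]

lemma expNeg_le_one (a : ℝ≥0∞) : expNeg a ≤ 1 := by simp [expNeg, EReal.coe_ennreal_nonneg]

lemma expNeg_ne_top (a : ℝ≥0∞) : expNeg a ≠ ∞ :=
  ne_top_of_le_ne_top ENNReal.one_ne_top (expNeg_le_one a)

lemma expNeg_eq_zero_iff {a : ℝ≥0∞} : expNeg a = 0 ↔ a = ∞ := by simp [expNeg]

lemma antitone_expNeg : Antitone expNeg := fun a b h => by
  simpa [expNeg, EReal.coe_ennreal_nonneg] using h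

lemma continuous_expNeg : Continuous expNeg :=
  ENNReal.continuous_exp.comp (continuous_neg.comp continuous_coe_ennreal_ereal)

@[fun_prop]
lemma measurable_expNeg : Measurable expNeg := continuous_expNeg.measurable

lemma expNeg_add (a b : ℝ≥0∞) : expNeg (a + b) = expNeg a * expNeg b := by
  rw [expNeg, expNeg, expNeg, ← EReal.exp_add, EReal.coe_ennreal_add, EReal.neg_add, sub_eq_add_neg]
  · left; simp
  · right; simp

lemma expNeg_ofReal {x : ℝ} (hx : 0 ≤ x) :
    expNeg (ENNReal.ofReal x) = ENNReal.ofReal (Real.exp (-x)) := by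
  rw [expNeg, EReal.coe_ennreal_ofReal, max_eq_left hx, ← EReal.coe_neg, EReal.exp_coe]

lemma expNeg_sum {ι : Type*} (s : Finset ι) (f : ι → ℝ≥0∞) :
    expNeg (∑ i ∈ s, f i) = ∏ i ∈ s, expNeg (f i) := by
  classical
  induction s using Finset.induction_on with
  | empty => simp
  | insert i s hi ih => rw [Finset.sum_insert hi, Finset.prod_insert hi, expNeg_add, ih]

lemma expNeg_mul_natCast (a : ℝ≥0∞) (n : ℕ) : expNeg (a * n) = expNeg a ^ n := by
  induction n with
  | zero => simp
  | succ n ih => rw [Nat.cast_succ, mul_add, mul_one, expNeg_add, ih, pow_succ]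

lemma tendsto_prod_expNeg {ι : Type*} (f : ι → ℝ≥0∞) :
    Filter.Tendsto (fun s : Finset ι => ∏ i ∈ s, expNeg (f i)) Filter.atTop
      (nhds (expNeg (∑' i, f i))) := by
  simp_rw [← expNeg_sum]
  exact (continuous_expNeg.tendsto _).comp ENNReal.summable.hasSum

/-- The Poisson generating function `E[x ^ N] = exp (-(1 - x) r)` at `x = expNeg c`; `c = ∞` is
included as `x = 0`. -/
lemma lintegral_expNeg_poisson (r : NNReal) (c : ℝ≥0∞) :
    ∫⁻ k, expNeg (c * (k : ℕ)) ∂(poissonMeasure r) = expNeg ((1 - expNeg c) * r) := by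
  obtain ⟨x, hx0, hx1, hx⟩ : ∃ x : ℝ, 0 ≤ x ∧ x ≤ 1 ∧ expNeg c = ENNReal.ofReal x :=
    ⟨(expNeg c).toReal, ENNReal.toReal_nonneg,
      ENNReal.toReal_le_of_le_ofReal zero_le_one (by simpa using expNeg_le_one c),
      (ENNReal.ofReal_toReal (expNeg_ne_top c)).symm⟩
  have hrhs : (1 - expNeg c) * r = ENNReal.ofReal ((1 - x) * r) := by
    rw [hx, ENNReal.ofReal_mul (by linarith), ENNReal.ofReal_sub _ hx0, ENNReal.ofReal_one,
      ENNReal.ofReal_coe_nnreal]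
  have hsum : HasSum (fun n : ℕ => Real.exp (-r) * r ^ n / (n.factorial) * x ^ n)
      (Real.exp (-((1 - x) * r))) := by
    convert! (NormedSpace.expSeries_div_hasSum_exp ((r : ℝ) * x)).mul_left (Real.exp (-r)) using 1
    · ext n; rw [mul_pow]; ring
    · rw [← Real.exp_eq_exp_ℝ, ← Real.exp_add]; congr 1; ring
  rw [hrhs, expNeg_ofReal (mul_nonneg (by linarith) r.coe_nonneg), ← hsum.tsum_eq,
    ENNReal.ofReal_tsum_of_nonneg (fun n => by positivity) hsum.summable, poissonMeasure,
    lintegral_sum_measure]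
  refine tsum_congr fun n => ?_
  rw [lintegral_smul_measure, lintegral_dirac, expNeg_mul_natCast, hx, smul_eq_mul,
    ENNReal.ofReal_mul (by positivity), ENNReal.ofReal_pow hx0]

lemma lintegral_countingMeasure {Ω : Type*} (X : ℕ → Ω → Plane) (ω : Ω) {h : Plane → ℝ≥0∞}
    (hh : Measurable h) : ∫⁻ x, h x ∂(countingMeasure X ω) = ∑' i, h (X i ω) := by
  rw [countingMeasure, lintegral_sum_measure]
  exact tsum_congr fun i => lintegral_dirac' _ hh

variable {Ω : Type*} [MeasurableSpace Ω] {P : Measure Ω} {lam : ℝ} {X : ℕ → Ω → Plane}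

lemma measurable_tsum_comp (hX : ∀ i, Measurable (X i)) {h : Plane → ℝ≥0∞} (hh : Measurable h) :
    Measurable fun ω => ∑' i, h (X i ω) :=
  Measurable.tsum fun i => hh.comp (hX i)

lemma measurable_countingMeasure (hX : ∀ i, Measurable (X i)) {B : Set Plane}
    (hB : MeasurableSet B) : Measurable fun ω => countingMeasure X ω B := by
  have : (fun ω => countingMeasure X ω B) = fun ω => ∑' i, B.indicator 1 (X i ω) := by
    ext ω
    rw [← lintegral_indicator_one hB, lintegral_countingMeasure X ω (measurable_one.indicator hB)]
  rw [this]
  exact measurable_tsum_comp hX (measurable_one.indicator hB)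

lemma lintegral_expNeg_count (hX : IsPoissonPointProcess lam X P) (hlam : 0 ≤ lam)
    {B : Set Plane} (hB : MeasurableSet B) (hfin : volume B ≠ ∞) (c : ℝ≥0∞) :
    ∫⁻ ω, expNeg (c * countingMeasure X ω B) ∂P =
      expNeg ((1 - expNeg c) * (ENNReal.ofReal lam • volume : Measure Plane) B) := by
  have hlaw := hX.hasLaw_count B hB hfin
  have hm : Measurable fun k : ℝ≥0∞ => expNeg (c * k) :=
    measurable_expNeg.comp (measurable_const.mul measurable_id)
  rw [← lintegral_map' (f := fun k => expNeg (c * k)) hm.aemeasurable hlaw.aemeasurable,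
    hlaw.map_eq, lintegral_map hm (by fun_prop), lintegral_expNeg_poisson]
  congr 2
  rw [Measure.smul_apply, smul_eq_mul]
  change ENNReal.ofReal (lam * volume.real B) = _
  rw [ENNReal.ofReal_mul hlam, measureReal_def, ENNReal.ofReal_toReal hfin]

/-- The sum of `h` over the points is a finite combination of the counts on the level sets of `h`.
These sets are disjoint, so the expectation factors into Poisson transforms. -/
lemma lintegral_expNeg_tsum_simpleFunc [IsProbabilityMeasure P]
    (hX : IsPoissonPointProcess lam X P) (hlam : 0 ≤ lam)
    (h : SimpleFunc Plane ℝ≥0∞) (hfin : ∀ c, c ≠ 0 → volume (h ⁻¹' {c}) ≠ ∞) :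
    ∫⁻ ω, expNeg (∑' i, h (X i ω)) ∂P =
      expNeg (∫⁻ x, (1 - expNeg (h x)) ∂(ENNReal.ofReal lam • volume : Measure Plane)) := by
  classical
  set Λ : Measure Plane := ENNReal.ofReal lam • volume
  -- The level set of `0` may have infinite area, and contributes nothing to either side.
  set s : Finset ℝ≥0∞ := h.range.filter (· ≠ 0) with hs
  let e : Fin s.card ≃ s := s.equivFin.symm
  let B : Fin s.card → Set Plane := fun k => h ⁻¹' {(e k : ℝ≥0∞)}
  have hBm : ∀ k, MeasurableSet (B k) := fun k => h.measurableSet_fiber _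
  have hBfin : ∀ k, volume (B k) ≠ ∞ := fun k =>
    hfin _ (Finset.mem_filter.mp (e k).2).2
  have hdisj : Pairwise fun k l => Disjoint (B k) (B l) := fun k l hkl =>
    Disjoint.preimage _ (by
      rw [Set.disjoint_singleton]
      exact fun H => hkl (e.injective (Subtype.ext H)))
  have hsum : ∀ (μ : Measure Plane) (F : ℝ≥0∞ → ℝ≥0∞), F 0 = 0 →
      ∫⁻ x, F (h x) ∂μ = ∑ k, F (e k) * μ (B k) := by
    intro μ F hF
    have h1 : ∫⁻ x, F (h x) ∂μ = (h.map F).lintegral μ := by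
      rw [← SimpleFunc.lintegral_eq_lintegral]; rfl
    rw [h1, SimpleFunc.map_lintegral, e.sum_comp (fun c : s => F c * μ (h ⁻¹' {(c : ℝ≥0∞)})),
      Finset.sum_coe_sort s (fun c => F c * μ (h ⁻¹' {c})), hs, Finset.sum_filter]
    refine Finset.sum_congr rfl fun c _ => ?_
    split_ifs with hc
    · rfl
    · rw [not_not.mp hc, hF, zero_mul]
  have hind := hX.indep_count _ B hBm hBfin hdisj
  have hL : ∀ ω, expNeg (∑' i, h (X i ω)) =
      ∏ k, expNeg ((e k : ℝ≥0∞) * countingMeasure X ω (B k)) := by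
    intro ω
    rw [← lintegral_countingMeasure X ω h.measurable, hsum _ (fun c => c) rfl, expNeg_sum]
  simp_rw [hL]
  have hm : ∀ k, Measurable fun a : ℝ≥0∞ => expNeg ((e k : ℝ≥0∞) * a) := fun k =>
    measurable_expNeg.comp (measurable_const.mul measurable_id)
  rw [lintegral_prod_eq_prod_lintegral_of_indepFun Finset.univ
    (fun k ω => expNeg ((e k : ℝ≥0∞) * countingMeasure X ω (B k)))
    (hind.comp (fun k a => expNeg ((e k : ℝ≥0∞) * a)) hm)
    (fun k => (hm k).comp (measurable_countingMeasure hX.measurable (hBm k)))]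
  rw [hsum Λ (fun c => 1 - expNeg c) (by simp), expNeg_sum]
  exact Finset.prod_congr rfl fun k _ => lintegral_expNeg_count hX hlam (hBm k) (hBfin k) _

/-- The Laplace functional of a homogeneous Poisson point process. -/
theorem lintegral_expNeg_tsum [IsProbabilityMeasure P]
    (hX : IsPoissonPointProcess lam X P) (hlam : 0 ≤ lam) {h : Plane → ℝ≥0∞} (hh : Measurable h) :
    ∫⁻ ω, expNeg (∑' i, h (X i ω)) ∂P =
      expNeg (∫⁻ x, (1 - expNeg (h x)) ∂(ENNReal.ofReal lam • volume : Measure Plane)) := by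
  set Λ : Measure Plane := ENNReal.ofReal lam • volume
  let S : ℕ → Set Plane := spanningSets volume
  -- Cutting off to sets of finite area makes every nonzero level set finite in area, while the
  -- sequence still increases to `h`.
  let f : ℕ → SimpleFunc Plane ℝ≥0∞ := fun n => (SimpleFunc.eapprox h n).restrict (S n)
  have hSm : ∀ n, MeasurableSet (S n) := measurableSet_spanningSets volume
  have hf : ∀ n x, f n x = (S n).indicator (SimpleFunc.eapprox h n) x := fun n x => by
    rw [SimpleFunc.restrict_apply _ (hSm n)]
  have hmono : ∀ x, Monotone fun n => f n x := by
    intro x m n hmn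
    simp only [hf]
    refine (Set.indicator_le_indicator_of_subset (monotone_spanningSets volume hmn)
      (fun _ => zero_le) x).trans ?_
    exact Set.indicator_le_indicator (SimpleFunc.monotone_eapprox h hmn x)
  have hlim : ∀ x, Filter.Tendsto (fun n => f n x) Filter.atTop (nhds (h x)) := by
    intro x
    have h1 : Filter.Tendsto (fun n => SimpleFunc.eapprox h n x) Filter.atTop (nhds (h x)) :=
      SimpleFunc.tendsto_eapprox hh x
    refine h1.congr' ?_
    have hx : x ∈ ⋃ n, S n := by simp [S, iUnion_spanningSets]
    obtain ⟨m, hxm⟩ := Set.mem_iUnion.mp hx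
    filter_upwards [Filter.eventually_ge_atTop m] with n hn
    rw [hf, Set.indicator_of_mem (monotone_spanningSets volume hn hxm)]
  have key : ∀ n, ∫⁻ ω, expNeg (∑' i, f n (X i ω)) ∂P = expNeg (∫⁻ x, (1 - expNeg (f n x)) ∂Λ) :=
    fun n => lintegral_expNeg_tsum_simpleFunc hX hlam (f n) fun c hc => by
      refine ne_top_of_le_ne_top (measure_spanningSets_lt_top volume n).ne
        (measure_mono fun x hx => ?_)
      by_contra hxS
      exact hc (by rw [← (show f n x = c from hx), hf, Set.indicator_of_notMem hxS])
  refine tendsto_nhds_unique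
    (f := fun n => ∫⁻ ω, expNeg (∑' i, f n (X i ω)) ∂P) (l := Filter.atTop) ?_ ?_
  · refine tendsto_lintegral_of_dominated_convergence (fun _ => 1)
      (fun n => measurable_expNeg.comp (measurable_tsum_comp hX.measurable (f n).measurable))
      (fun n => .of_forall fun ω => expNeg_le_one _) (by simp) (.of_forall fun ω => ?_)
    refine (continuous_expNeg.tendsto _).comp ?_
    simp_rw [← lintegral_countingMeasure X ω (f _).measurable, ← lintegral_countingMeasure X ω hh]
    exact lintegral_tendsto_of_tendsto_of_monotone (fun n => (f n).measurable.aemeasurable)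
      (.of_forall hmono) (.of_forall hlim)
  · simp_rw [key]
    refine (continuous_expNeg.tendsto _).comp ?_
    refine lintegral_tendsto_of_tendsto_of_monotone
      (fun n => (measurable_const.sub (measurable_expNeg.comp (f n).measurable)).aemeasurable)
      (.of_forall fun x m n hmn => tsub_le_tsub_left (antitone_expNeg (hmono x hmn)) 1)
      (.of_forall fun x => ?_)
    exact ENNReal.Tendsto.sub tendsto_const_nhds ((continuous_expNeg.tendsto _).comp (hlim x))
      (.inl ENNReal.one_ne_top)

end D2D
end

/-! ### Campbell-Mecke formula, by differentiating the Laplace functional -/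

section
namespace D2D

open Filter Topology

lemma one_sub_expNeg_le (d : ℝ≥0∞) : 1 - expNeg d ≤ d := by
  induction d with
  | top => simp
  | coe d =>
    rw [tsub_le_iff_right, ← ENNReal.ofReal_coe_nnreal, expNeg_ofReal d.coe_nonneg,
      ← ENNReal.ofReal_add d.coe_nonneg (Real.exp_pos _).le, ← ENNReal.ofReal_one]
    exact ENNReal.ofReal_le_ofReal (by linarith [Real.add_one_le_exp (-(d : ℝ))])

lemma mul_expNeg_le_one_sub (d : ℝ≥0∞) : d * expNeg d ≤ 1 - expNeg d := by
  induction d with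
  | top => simp
  | coe d =>
    rw [← ENNReal.ofReal_coe_nnreal, expNeg_ofReal d.coe_nonneg, ← ENNReal.ofReal_one,
      ← ENNReal.ofReal_mul d.coe_nonneg, ← ENNReal.ofReal_sub _ (Real.exp_pos _).le]
    refine ENNReal.ofReal_le_ofReal ?_
    have h1 := Real.add_one_le_exp (d : ℝ)
    have h2 : Real.exp d * Real.exp (-(d : ℝ)) = 1 := by rw [← Real.exp_add]; simp
    nlinarith [Real.exp_pos (-(d : ℝ))]

lemma one_sub_mul_eq {x y : ℝ≥0∞} (hx : x ≤ 1) (hy : y ≤ 1) :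
    1 - x * y = (1 - x) + x * (1 - y) := by
  rw [ENNReal.mul_sub fun _ _ => ne_top_of_le_ne_top ENNReal.one_ne_top hx, mul_one,
    tsub_add_tsub_cancel hx (mul_le_of_le_one_right' hy)]

/-- Difference quotient of `t ↦ 1 - exp (-t a)` at `0`, with step `2⁻ⁿ`. -/
noncomputable def expNegQuot (n : ℕ) (a : ℝ≥0∞) : ℝ≥0∞ := 2 ^ n * (1 - expNeg (a / 2 ^ n))

lemma measurable_expNegQuot (n : ℕ) : Measurable (expNegQuot n) :=
  measurable_const.mul (measurable_const.sub (measurable_expNeg.comp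
    (measurable_id.div measurable_const)))

/-- Halving the step: with `q = expNeg (a / 2 ^ (n + 1))`, `1 - q ^ 2 = (1 - q) + q (1 - q) ≤ 2 (1 -
q)`. Monotonicity allows monotone convergence, so the derivative needs no integrability. -/
lemma monotone_expNegQuot (a : ℝ≥0∞) : Monotone fun n => expNegQuot n a := by
  refine monotone_nat_of_le_succ fun n => ?_
  have h1 : a / 2 ^ n = a / 2 ^ (n + 1) + a / 2 ^ (n + 1) := by
    rw [← ENNReal.add_halves (a / 2 ^ n), pow_succ,
      ENNReal.div_eq_inv_mul (b := 2 ^ n * 2),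
      ENNReal.mul_inv (.inr (by simp)) (.inr (by simp)), ENNReal.div_eq_inv_mul (b := 2),
      ENNReal.div_eq_inv_mul (b := 2 ^ n), mul_comm (2 ^ n)⁻¹ 2⁻¹, mul_assoc]
  simp only [expNegQuot]
  rw [h1, expNeg_add, one_sub_mul_eq (expNeg_le_one _) (expNeg_le_one _), pow_succ, mul_assoc,
    two_mul]
  gcongr
  exact mul_le_of_le_one_left' (expNeg_le_one _)

/-- A squeeze by `D exp (-D) ≤ 1 - exp (-D) ≤ D`: a finite limit of `2 ^ n * D n` forces `D n → 0`,
so both bounds have the same limit. -/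
lemma tendsto_two_pow_mul_one_sub_expNeg_of_ne_top {D : ℕ → ℝ≥0∞} {d : ℝ≥0∞} (hd : d ≠ ∞)
    (hD : Tendsto (fun n => 2 ^ n * D n) atTop (𝓝 d)) :
    Tendsto (fun n => 2 ^ n * (1 - expNeg (D n))) atTop (𝓝 d) := by
  have h0 : Tendsto D atTop (𝓝 0) := by
    have h1 : Tendsto (fun n : ℕ => (2⁻¹ : ℝ≥0∞) ^ n) atTop (𝓝 0) :=
      ENNReal.tendsto_pow_atTop_nhds_zero_of_lt_one (by simp)
    have h2 := ENNReal.Tendsto.mul h1 (.inr hd) hD (.inr ENNReal.zero_ne_top)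
    rw [zero_mul] at h2
    refine h2.congr fun n => ?_
    rw [← mul_assoc, ← mul_pow, ENNReal.inv_mul_cancel (by simp) (by simp), one_pow, one_mul]
  have h1 : Tendsto (fun n => expNeg (D n)) atTop (𝓝 1) := by
    rw [← expNeg_zero]
    exact (continuous_expNeg.tendsto 0).comp h0
  have h2 := ENNReal.Tendsto.mul hD (.inr ENNReal.one_ne_top) h1 (.inr hd)
  rw [mul_one] at h2
  refine tendsto_of_tendsto_of_tendsto_of_le_of_le h2 hD (fun n => ?_) fun n => ?_
  · simp only [mul_assoc]
    gcongr
    exact mul_expNeg_le_one_sub _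
  · simp only
    gcongr
    exact one_sub_expNeg_le _

lemma tendsto_expNegQuot (a : ℝ≥0∞) : Tendsto (fun n => expNegQuot n a) atTop (𝓝 a) := by
  rcases eq_or_ne a ∞ with rfl | ha
  · have h : ∀ n, expNegQuot n ∞ = 2 ^ n := fun n => by
      rw [expNegQuot, ENNReal.top_div_of_ne_top (by simp)]; simp
    simp_rw [h]
    exact ENNReal.tendsto_pow_atTop_nhds_top_iff.mpr (by norm_num)
  · refine tendsto_two_pow_mul_one_sub_expNeg_of_ne_top ha ?_
    refine tendsto_const_nhds.congr fun n => ?_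
    rw [ENNReal.mul_div_cancel (by simp) (by simp)]

lemma tendsto_two_pow_mul_one_sub_expNeg {D : ℕ → ℝ≥0∞} {d : ℝ≥0∞}
    (hD : Tendsto (fun n => 2 ^ n * D n) atTop (𝓝 d)) :
    Tendsto (fun n => 2 ^ n * (1 - expNeg (D n))) atTop (𝓝 d) := by
  rcases eq_or_ne d ∞ with rfl | hd
  · rw [ENNReal.tendsto_nhds_top_iff_nnreal] at hD ⊢
    intro M
    -- Eventually `D n` exceeds `(M + 1) / 2 ^ n`, whose quotients tend to `M + 1` and so pass `M`.
    have h1 : (M : ℝ≥0∞) < (M + 1 : NNReal) := by exact_mod_cast lt_add_one M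
    filter_upwards [hD (M + 1), (tendsto_expNegQuot (M + 1 : NNReal)).eventually_const_lt h1]
      with n hn hn'
    refine hn'.trans_le ?_
    rw [expNegQuot]
    gcongr
    exact antitone_expNeg (ENNReal.div_le_of_le_mul' hn.le)
  · exact tendsto_two_pow_mul_one_sub_expNeg_of_ne_top hd hD

variable {Ω : Type*} [MeasurableSpace Ω] {P : Measure Ω} {lam : ℝ} {X : ℕ → Ω → Plane}

/-- The Campbell-Mecke formula for exponential functionals of a Poisson process. -/
theorem lintegral_expNeg_tsum_mul_tsum [IsProbabilityMeasure P]
    (hX : IsPoissonPointProcess lam X P) (hlam : 0 ≤ lam) {h f : Plane → ℝ≥0∞}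
    (hh : Measurable h) (hf : Measurable f) :
    ∫⁻ ω, expNeg (∑' i, h (X i ω)) * ∑' i, f (X i ω) ∂P =
      expNeg (∫⁻ x, (1 - expNeg (h x)) ∂(ENNReal.ofReal lam • volume : Measure Plane)) *
        ∫⁻ x, expNeg (h x) * f x ∂(ENNReal.ofReal lam • volume : Measure Plane) := by
  set Λ : Measure Plane := ENNReal.ofReal lam • volume
  set A := ∫⁻ x, (1 - expNeg (h x)) ∂Λ
  -- The increase of the exponent `A` when `h` is replaced by `h + f / 2 ^ n`.
  let D : ℕ → ℝ≥0∞ := fun n => ∫⁻ x, expNeg (h x) * (1 - expNeg (f x / 2 ^ n)) ∂Λ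
  have mH := measurable_tsum_comp hX.measurable hh
  have mF := measurable_tsum_comp hX.measurable hf
  have mEH : Measurable fun ω => expNeg (∑' i, h (X i ω)) := measurable_expNeg.comp mH
  have mh : Measurable fun x => expNeg (h x) := measurable_expNeg.comp hh
  have mf : ∀ n : ℕ, Measurable fun x => f x / 2 ^ n := fun n => hf.div measurable_const
  have key : ∀ n, ∫⁻ ω, expNeg (∑' i, h (X i ω)) * expNegQuot n (∑' i, f (X i ω)) ∂P =
      expNeg A * (2 ^ n * (1 - expNeg (D n))) := by
    intro n
    have hpt : ∀ ω, expNeg (∑' i, h (X i ω)) * expNegQuot n (∑' i, f (X i ω)) =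
        2 ^ n * (expNeg (∑' i, h (X i ω)) - expNeg (∑' i, (h (X i ω) + f (X i ω) / 2 ^ n))) := by
      intro ω
      rw [ENNReal.summable.tsum_add ENNReal.summable, expNeg_add, expNegQuot]
      simp_rw [div_eq_mul_inv]
      rw [ENNReal.tsum_mul_right, mul_left_comm, ENNReal.mul_sub fun _ _ => expNeg_ne_top _,
        mul_one]
    have hAD : ∫⁻ x, (1 - expNeg (h x + f x / 2 ^ n)) ∂Λ = A + D n := by
      rw [← lintegral_add_left (f := fun x => 1 - expNeg (h x)) (measurable_const.sub mh)]
      refine lintegral_congr fun x => ?_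
      rw [expNeg_add, one_sub_mul_eq (expNeg_le_one _) (expNeg_le_one _)]
    have mHF := measurable_tsum_comp hX.measurable (hh.add (mf n))
    have hL1 := lintegral_expNeg_tsum hX hlam hh
    have hL2 := lintegral_expNeg_tsum hX hlam (hh.add (mf n))
    simp only [Pi.add_apply] at mHF hL2
    have mEHF : Measurable fun ω => expNeg (∑' i, (h (X i ω) + f (X i ω) / 2 ^ n)) :=
      measurable_expNeg.comp mHF
    simp_rw [hpt]
    rw [lintegral_const_mul' _ _ (by simp),
      lintegral_sub mEHF, hL1, hL2, hAD, expNeg_add, mul_left_comm,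
      ENNReal.mul_sub fun _ _ => expNeg_ne_top _, mul_one]
    · rw [hL2]; exact expNeg_ne_top _
    · exact .of_forall fun ω => antitone_expNeg (ENNReal.tsum_le_tsum fun i => le_self_add)
  refine tendsto_nhds_unique (l := atTop) (f := fun n =>
    ∫⁻ ω, expNeg (∑' i, h (X i ω)) * expNegQuot n (∑' i, f (X i ω)) ∂P) ?_ ?_
  · refine lintegral_tendsto_of_tendsto_of_monotone
      (fun n => (mEH.mul ((measurable_expNegQuot n).comp mF)).aemeasurable)
      (.of_forall fun ω m n hmn => mul_le_mul_right (monotone_expNegQuot _ hmn) _)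
      (.of_forall fun ω => ENNReal.Tendsto.const_mul (tendsto_expNegQuot _)
        (.inr (expNeg_ne_top _)))
  · simp_rw [key]
    refine ENNReal.Tendsto.const_mul (tendsto_two_pow_mul_one_sub_expNeg ?_)
      (.inr (expNeg_ne_top _))
    have hD : ∀ n, 2 ^ n * D n = ∫⁻ x, expNeg (h x) * expNegQuot n (f x) ∂Λ := by
      intro n
      rw [← lintegral_const_mul _ (by fun_prop)]
      exact lintegral_congr fun x => by rw [expNegQuot, mul_left_comm]
    simp_rw [hD]
    exact lintegral_tendsto_of_tendsto_of_monotone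
      (fun n => (mh.mul ((measurable_expNegQuot n).comp hf)).aemeasurable)
      (.of_forall fun ω m n hmn => mul_le_mul_right (monotone_expNegQuot _ hmn) _)
      (.of_forall fun ω => ENNReal.Tendsto.const_mul (tendsto_expNegQuot _)
        (.inr (expNeg_ne_top _)))

end D2D
end

/-! ### Averaging over displacements and fading -/

section
namespace D2D

open Filter Topology

/-- Tonelli for the product law: freeze `U` and average over an independent copy of `V`. -/
lemma lintegral_comp_prodMk_of_indepFun {Ω A B : Type*} [MeasurableSpace Ω] [MeasurableSpace A]
    [MeasurableSpace B] {P : Measure Ω} [IsProbabilityMeasure P] {U : Ω → A} {V : Ω → B}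
    (h : IndepFun U V P) (hU : Measurable U) (hV : Measurable V) {K : A × B → ℝ≥0∞}
    (hK : Measurable K) :
    ∫⁻ ω, K (U ω, V ω) ∂P = ∫⁻ ω, ∫⁻ ω', K (U ω, V ω') ∂P ∂P := by
  have := Measure.isProbabilityMeasure_map (μ := P) hV.aemeasurable
  rw [← lintegral_map hK (hU.prodMk hV),
    (indepFun_iff_map_prod_eq_prod_map_map hU.aemeasurable hV.aemeasurable).mp h,
    lintegral_prod _ hK.aemeasurable, lintegral_map hK.lintegral_prod_right' hU]
  refine lintegral_congr fun ω => ?_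
  exact lintegral_map (hK.comp measurable_prodMk_left) hV

variable {Ω : Type*} [MeasurableSpace Ω] {P : Measure Ω} {lam σ : ℝ} {X Y : ℕ → Ω → Plane}
  {g : ℕ → Ω → ℝ}

/-- The common law of the marks (displacement and fading gain) of the clusters. -/
noncomputable def markLaw (σ : ℝ) : Measure (Plane × ℝ) :=
  (gaussianDisplacement σ).prod (expMeasure 1)

instance : IsProbabilityMeasure (expMeasure 1) := isProbabilityMeasure_expMeasure one_pos

lemma IsClusterNetwork.isProbabilityMeasure_gaussianDisplacement [IsProbabilityMeasure P]
    (hnet : IsClusterNetwork lam σ X Y g P) : IsProbabilityMeasure (gaussianDisplacement σ) := by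
  rw [← (hnet.hasLaw_displacement 0).map_eq]
  exact Measure.isProbabilityMeasure_map (hnet.measurable_displacement 0).aemeasurable

lemma IsClusterNetwork.isProbabilityMeasure_markLaw [IsProbabilityMeasure P]
    (hnet : IsClusterNetwork lam σ X Y g P) : IsProbabilityMeasure (markLaw σ) := by
  have := hnet.isProbabilityMeasure_gaussianDisplacement
  rw [markLaw]
  infer_instance

/-- Independence is given within each of the sequences `Y` and `g`, and between them. So the gains
are averaged first with the displacements frozen, then the displacements. -/
lemma IsClusterNetwork.lintegral_prod_marks [IsProbabilityMeasure P]
    (hnet : IsClusterNetwork lam σ X Y g P) (s : Finset ℕ) {F : ℕ → Plane × ℝ → ℝ≥0∞}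
    (hF : ∀ i, Measurable (F i)) :
    ∫⁻ ω, ∏ i ∈ s, F i (Y i ω, g i ω) ∂P = ∏ i ∈ s, ∫⁻ m, F i m ∂(markLaw σ) := by
  let K : (ℕ → Plane) × (ℕ → ℝ) → ℝ≥0∞ := fun p => ∏ i ∈ s, F i (p.1 i, p.2 i)
  have hK : Measurable K := Finset.measurable_prod _ fun i _ => (hF i).comp (by fun_prop)
  have h1 := lintegral_comp_prodMk_of_indepFun hnet.indep_displacement_fading
    (measurable_pi_lambda _ hnet.measurable_displacement)
    (measurable_pi_lambda _ hnet.measurable_fading) hK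
  have h2 : ∀ ω, ∫⁻ ω', ∏ i ∈ s, F i (Y i ω, g i ω') ∂P =
      ∏ i ∈ s, ∫⁻ t, F i (Y i ω, t) ∂(expMeasure 1) := by
    intro ω
    have hm : ∀ i, Measurable fun t => F i (Y i ω, t) := fun i =>
      (hF i).comp measurable_prodMk_left
    rw [lintegral_prod_eq_prod_lintegral_of_indepFun s (fun i ω' => F i (Y i ω, g i ω'))
      (hnet.indep_fading.comp (fun i t => F i (Y i ω, t)) hm)
      (fun i => (hm i).comp (hnet.measurable_fading i))]
    refine Finset.prod_congr rfl fun i _ => ?_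
    rw [← (hnet.hasLaw_fading i).map_eq, lintegral_map (hm i) (hnet.measurable_fading i)]
  have hm : ∀ i, Measurable fun y => ∫⁻ t, F i (y, t) ∂(expMeasure 1) := fun i =>
    (hF i).lintegral_prod_right'
  refine h1.trans ?_
  simp only [K, h2]
  rw [lintegral_prod_eq_prod_lintegral_of_indepFun s
    (fun i ω => ∫⁻ t, F i (Y i ω, t) ∂(expMeasure 1))
    (hnet.indep_displacement.comp (fun i y => ∫⁻ t, F i (y, t) ∂(expMeasure 1)) hm)
    (fun i => (hm i).comp (hnet.measurable_displacement i))]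
  refine Finset.prod_congr rfl fun i _ => ?_
  rw [markLaw, lintegral_prod _ (hF i).aemeasurable, ← (hnet.hasLaw_displacement i).map_eq,
    lintegral_map (hm i) (hnet.measurable_displacement i)]

/-- Passage from finite to infinite products, by convergence dominated by `1`. Writing each factor
as `expNeg (h i)` keeps the limit in the form to which the Laplace functional applies. -/
lemma IsClusterNetwork.lintegral_expNeg_tsum_marks [IsProbabilityMeasure P]
    (hnet : IsClusterNetwork lam σ X Y g P) {w : ℕ → Plane × ℝ → ℝ≥0∞}
    (hw : ∀ i, Measurable (w i)) {h : ℕ → ℝ≥0∞}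
    (hh : ∀ i, expNeg (h i) = ∫⁻ m, expNeg (w i m) ∂(markLaw σ)) :
    ∫⁻ ω, expNeg (∑' i, w i (Y i ω, g i ω)) ∂P = expNeg (∑' i, h i) := by
  have hm : ∀ i, Measurable fun ω => expNeg (w i (Y i ω, g i ω)) := fun i =>
    measurable_expNeg.comp ((hw i).comp
      ((hnet.measurable_displacement i).prodMk (hnet.measurable_fading i)))
  refine tendsto_nhds_unique (l := (atTop : Filter (Finset ℕ)))
    (f := fun s => ∫⁻ ω, ∏ i ∈ s, expNeg (w i (Y i ω, g i ω)) ∂P) ?_ ?_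
  · refine tendsto_lintegral_filter_of_dominated_convergence (fun _ => 1)
      (.of_forall fun s => Finset.measurable_prod _ fun i _ => hm i)
      (.of_forall fun s => .of_forall fun ω => ?_) (by simp)
      (.of_forall fun ω => tendsto_prod_expNeg _)
    exact Finset.prod_le_one' fun i _ => expNeg_le_one _
  · have h1 := tendsto_prod_expNeg h
    simp_rw [hh] at h1
    exact h1.congr fun s => (hnet.lintegral_prod_marks s fun i => measurable_expNeg.comp (hw i)).symm

/-- Averaging over the marks, conditionally on the cluster centres. -/
lemma IsClusterNetwork.setLIntegral_expNeg_tsum_marks [IsProbabilityMeasure P]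
    (hnet : IsClusterNetwork lam σ X Y g P) {w : Plane × (Plane × ℝ) → ℝ≥0∞}
    (hw : Measurable w) {h : Plane → ℝ≥0∞}
    (hh : ∀ x, expNeg (h x) = ∫⁻ m, expNeg (w (x, m)) ∂(markLaw σ))
    (i : ℕ) {B : Set Plane} (hB : MeasurableSet B) (S : Set ℕ) :
    ∫⁻ ω in X i ⁻¹' B, expNeg (∑' j : S, w (X j ω, (Y j ω, g j ω))) ∂P =
      ∫⁻ ω in X i ⁻¹' B, expNeg (∑' j : S, h (X j ω)) ∂P := by
  classical
  have hXB : MeasurableSet (X i ⁻¹' B) := hnet.parents.measurable i hB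
  -- Zero weight outside `S` turns the sum over `S` into one over `ℕ`.
  let ws : ℕ → Plane × (Plane × ℝ) → ℝ≥0∞ := fun j p => if j ∈ S then w p else 0
  have hws : ∀ j, Measurable (ws j) := fun j => by
    by_cases hj : j ∈ S <;> simp only [ws, hj, if_true, if_false]
    exacts [hw, measurable_const]
  -- The indicator involves the centres only, so it is a constant in the average over the marks.
  let K : (ℕ → Plane) × (ℕ → Plane × ℝ) → ℝ≥0∞ := fun p =>
    B.indicator 1 (p.1 i) * expNeg (∑' j, ws j (p.1 j, p.2 j))
  have hK : Measurable K :=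
    ((measurable_one.indicator hB).comp (by fun_prop)).mul (measurable_expNeg.comp
      (Measurable.tsum fun j => (hws j).comp (by fun_prop)))
  have h1 := lintegral_comp_prodMk_of_indepFun hnet.indep_parents_marks
    (measurable_pi_lambda _ hnet.parents.measurable)
    (measurable_pi_lambda _ fun i =>
      (hnet.measurable_displacement i).prodMk (hnet.measurable_fading i)) hK
  have h2 : ∀ ω, ∫⁻ ω', expNeg (∑' j, ws j (X j ω, (Y j ω', g j ω'))) ∂P =
      expNeg (∑' j : S, h (X j ω)) := by
    intro ω
    rw [tsum_subtype S fun j => h (X j ω)]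
    refine hnet.lintegral_expNeg_tsum_marks
      (fun j => (hws j).comp measurable_prodMk_left) fun j => ?_
    have := hnet.isProbabilityMeasure_markLaw
    by_cases hj : j ∈ S <;> simp [ws, hj, hh]
  rw [← lintegral_indicator hXB, ← lintegral_indicator hXB]
  calc _ = ∫⁻ ω, K (fun i => X i ω, fun i => (Y i ω, g i ω)) ∂P := by
        refine lintegral_congr fun ω => ?_
        have h3 : ∑' j : S, w (X j ω, (Y j ω, g j ω)) = ∑' j, ws j (X j ω, (Y j ω, g j ω)) := by
          rw [tsum_subtype S fun j => w (X j ω, (Y j ω, g j ω))]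
          exact tsum_congr fun j => by simp [ws, Set.indicator_apply]
        by_cases hx : X i ω ∈ B <;> simp [K, Set.indicator_apply, hx, h3]
    _ = _ := h1
    _ = _ := by
        refine lintegral_congr fun ω => ?_
        simp only [K]
        rw [lintegral_const_mul', h2]
        · by_cases hx : X i ω ∈ B <;> simp [hx]
        · by_cases hx : X i ω ∈ B <;> simp [hx]

/-- Minus the logarithm of the conditional Laplace transform, given the location of the centre, of
the contribution `w` of a cluster. -/
noncomputable def markExponent (σ : ℝ) (w : Plane × (Plane × ℝ) → ℝ≥0∞) (x : Plane) : ℝ≥0∞ :=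
  (-(ENNReal.log (∫⁻ m, expNeg (w (x, m)) ∂(markLaw σ)))).toENNReal

lemma lintegral_expNeg_le_one {A : Type*} [MeasurableSpace A] (μ : Measure A)
    [IsProbabilityMeasure μ] (f : A → ℝ≥0∞) : ∫⁻ m, expNeg (f m) ∂μ ≤ 1 :=
  (lintegral_mono fun m => expNeg_le_one _).trans (by simp)

/-- The integral is at most `1` for a probability law, so minus its logarithm is nonnegative and
truncation to `[0, ∞]` loses nothing. -/
lemma expNeg_markExponent [IsProbabilityMeasure (markLaw σ)] (w : Plane × (Plane × ℝ) → ℝ≥0∞)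
    (x : Plane) : expNeg (markExponent σ w x) = ∫⁻ m, expNeg (w (x, m)) ∂(markLaw σ) := by
  rw [expNeg, markExponent, EReal.coe_toENNReal, neg_neg, ENNReal.exp_log]
  rw [EReal.neg_nonneg, ← ENNReal.log_one]
  exact ENNReal.log_monotone (lintegral_expNeg_le_one _ _)

lemma measurable_markExponent [IsProbabilityMeasure (markLaw σ)]
    {w : Plane × (Plane × ℝ) → ℝ≥0∞} (hw : Measurable w) : Measurable (markExponent σ w) := by
  have h1 : Measurable fun x => ∫⁻ m, expNeg (w (x, m)) ∂(markLaw σ) :=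
    (measurable_expNeg.comp hw).lintegral_prod_right'
  exact h1.ennreal_log.neg.ereal_toENNReal

end D2D
end

/-! ### The integral over the plane -/

section
namespace D2D

/-- Reading `1 - exp (-c)` as the probability that an auxiliary exponential variable is below `c`
later turns the plane integral into a mean area of discs. -/
lemma one_sub_expNeg_ofReal {c : ℝ} (hc : 0 ≤ c) :
    1 - expNeg (ENNReal.ofReal c) = expMeasure 1 (Set.Iio c) := by
  have h1 : expMeasure 1 (Set.Iio c) = expMeasure 1 (Set.Iic c) :=
    measure_congr (by
      have : NullSingletonClass (expMeasure 1) := by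
        rw [expMeasure, gammaMeasure]; infer_instance
      exact Iio_ae_eq_Iic)
  have h2 := cdf_expMeasure_eq one_pos c
  rw [cdf_eq_real, if_pos hc, one_mul] at h2
  rw [h1, ← ENNReal.ofReal_toReal (measure_ne_top (expMeasure 1) (Set.Iic c)), ← measureReal_def,
    h2, ENNReal.ofReal_sub _ (Real.exp_pos _).le, expNeg_ofReal hc, ENNReal.ofReal_one]

lemma lintegral_expMeasure (f : ℝ → ℝ≥0∞) (hf : Measurable f) :
    ∫⁻ u, f u ∂(expMeasure 1) = ∫⁻ u in Set.Ioi 0, ENNReal.ofReal (Real.exp (-u)) * f u := by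
  rw [expMeasure, gammaMeasure, lintegral_withDensity_eq_lintegral_mul _
    (f := gammaPDF 1 1) (measurable_gammaPDFReal 1 1).ennreal_ofReal hf, setLIntegral_congr Ioi_ae_eq_Ici,
    ← lintegral_indicator measurableSet_Ici]
  refine lintegral_congr fun u => ?_
  rcases le_or_gt 0 u with hu | hu
  · simp [gammaPDF, gammaPDFReal, hu]
  · simp [gammaPDF, gammaPDFReal, hu.not_ge]

lemma ae_expMeasure_pos : ∀ᵐ u ∂(expMeasure 1), 0 < u := by
  have h : expMeasure 1 (Set.Iic 0) = 0 := by
    rw [← lintegral_indicator_one measurableSet_Iic,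
      lintegral_expMeasure _ (measurable_one.indicator measurableSet_Iic),
      setLIntegral_congr_fun (g := fun _ => 0) measurableSet_Ioi, lintegral_zero]
    intro u hu
    simp [(Set.mem_Ioi.mp hu).not_ge]
  rw [ae_iff]
  simpa [Set.Iic] using h

/-- Moments of the exponential law. -/
lemma lintegral_rpow_expMeasure {a : ℝ} (ha : -1 < a) :
    ∫⁻ u, ENNReal.ofReal (u ^ a) ∂(expMeasure 1) = ENNReal.ofReal (Real.Gamma (1 + a)) := by
  rw [lintegral_expMeasure _ (by fun_prop), Real.Gamma_eq_integral (by linarith),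
    ofReal_integral_eq_lintegral_ofReal (Real.GammaIntegral_convergent (by linarith))]
  · refine setLIntegral_congr_fun measurableSet_Ioi fun u hu => ?_
    rw [← ENNReal.ofReal_mul (Real.exp_pos _).le, add_sub_cancel_left]
  · filter_upwards [ae_restrict_mem measurableSet_Ioi] with u hu
    exact mul_nonneg (Real.exp_pos _).le (Real.rpow_nonneg (le_of_lt hu) _)

lemma volume_setOf_lt_mul_norm_rpow {α c u : ℝ} (hα : 0 < α) (hc : 0 ≤ c) (hu : 0 < u) :
    volume {z : Plane | u < c * ‖z‖ ^ (-α)} =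
      ENNReal.ofReal (Real.pi * c ^ (2 / α)) * ENNReal.ofReal (u ^ (-(2 / α))) := by
  have hset : {z : Plane | u < c * ‖z‖ ^ (-α)} = Metric.ball 0 ((c / u) ^ (1 / α)) \ {0} := by
    ext z
    rcases eq_or_ne z 0 with rfl | hz
    -- By convention `0 ^ (-α) = 0`, so the origin is not in the set: the disc is punctured.
    · simp [Real.zero_rpow (neg_ne_zero.mpr hα.ne'), hu.le]
    · have hz' : 0 < ‖z‖ := norm_pos_iff.mpr hz
      simp only [Set.mem_ofPred_eq, Set.mem_sdiff, mem_ball_zero_iff, Set.mem_singleton_iff, hz,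
        not_false_eq_true, and_true]
      rw [one_div, Real.lt_rpow_inv_iff_of_pos hz'.le (by positivity) hα, Real.rpow_neg hz'.le,
        ← div_eq_mul_inv, lt_div_iff₀ (by positivity), lt_div_iff₀ hu, mul_comm]
  rw [hset, measure_sdiff_null (measure_singleton _), EuclideanSpace.volume_ball_fin_two,
    ← ENNReal.ofReal_pow (by positivity), ← ENNReal.ofReal_mul (by positivity),
    ← ENNReal.ofReal_mul (by positivity), ← Real.rpow_natCast, ← Real.rpow_mul (by positivity),
    Real.div_rpow hc hu.le, Real.rpow_neg hu.le]
  congr 1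
  have : 1 / α * (2 : ℕ) = 2 / α := by push_cast; ring
  rw [this]
  ring

/-- After Tonelli, the disc of area `π (c / u) ^ (2/α)` is averaged over exponential `u`. The moment
of order `-2/α` is `Γ(1 - 2/α)`, and `α > 2` puts this order above `-1`. -/
lemma lintegral_one_sub_expNeg_mul_norm_rpow {α c : ℝ} (hα : 2 < α) (hc : 0 ≤ c) :
    ∫⁻ z : Plane, (1 - expNeg (ENNReal.ofReal (c * ‖z‖ ^ (-α)))) =
      ENNReal.ofReal (Real.pi * c ^ (2 / α)) * ENNReal.ofReal (Real.Gamma (1 - 2 / α)) := by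
  have hmeas : MeasurableSet {p : Plane × ℝ | p.2 < c * ‖p.1‖ ^ (-α)} :=
    measurableSet_lt (by fun_prop) (by fun_prop)
  have h1 : ∀ z : Plane, 1 - expNeg (ENNReal.ofReal (c * ‖z‖ ^ (-α))) =
      ∫⁻ u, {p : Plane × ℝ | p.2 < c * ‖p.1‖ ^ (-α)}.indicator 1 (z, u) ∂(expMeasure 1) := by
    intro z
    rw [one_sub_expNeg_ofReal (by positivity), ← lintegral_indicator_one measurableSet_Iio]
    rfl
  simp_rw [h1]
  rw [lintegral_lintegral_swap (f := fun z u =>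
    {p : Plane × ℝ | p.2 < c * ‖p.1‖ ^ (-α)}.indicator 1 (z, u))
    (measurable_one.indicator hmeas).aemeasurable]
  have h2 : ∀ u : ℝ, 0 < u →
      ∫⁻ z : Plane, {p : Plane × ℝ | p.2 < c * ‖p.1‖ ^ (-α)}.indicator 1 (z, u) =
      ENNReal.ofReal (Real.pi * c ^ (2 / α)) * ENNReal.ofReal (u ^ (-(2 / α))) := by
    intro u hu
    rw [← volume_setOf_lt_mul_norm_rpow (by linarith) hc hu,
      ← lintegral_indicator_one (measurableSet_lt (by fun_prop) (by fun_prop))]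
    rfl
  rw [lintegral_congr_ae (ae_expMeasure_pos.mono h2), lintegral_const_mul _ (by fun_prop),
    lintegral_rpow_expMeasure, sub_eq_add_neg]
  rw [neg_lt_neg_iff, div_lt_one (by linarith)]
  exact hα

/-- The contribution, multiplied by `s`, of a cluster with centre `x` whose transmitter is at
`x + k y` and has fading gain `t`. -/
noncomputable def clusterPower (α Pd s : ℝ) (k : Plane → Plane) (p : Plane × (Plane × ℝ)) :
    ℝ≥0∞ :=
  ENNReal.ofReal (s * (Pd * p.2.2 * ‖p.1 + k p.2.1‖ ^ (-α)))

lemma measurable_clusterPower {α Pd s : ℝ} {k : Plane → Plane} (hk : Measurable k) :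
    Measurable (clusterPower α Pd s k) := by
  unfold clusterPower
  fun_prop

/-- For a fixed mark, translating by `k y` eliminates the displacement, so the value does not depend
on `k`. Averaging `t ^ (2/α)` over the gain gives `Γ(1 + 2/α)`. -/
lemma lintegral_one_sub_lintegral_expNeg_clusterPower {α Pd s σ : ℝ} (hα : 2 < α) (hPd : 0 < Pd)
    (hs : 0 ≤ s) [IsProbabilityMeasure (gaussianDisplacement σ)] {k : Plane → Plane}
    (hk : Measurable k) :
    ∫⁻ x, (1 - ∫⁻ m, expNeg (clusterPower α Pd s k (x, m)) ∂(markLaw σ)) =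
      ENNReal.ofReal (Real.pi * (s * Pd) ^ (2 / α) * Real.Gamma (1 + 2 / α) *
        Real.Gamma (1 - 2 / α)) := by
  have : IsProbabilityMeasure (markLaw σ) := by rw [markLaw]; infer_instance
  have hα0 : 0 < 2 / α := by positivity
  have hα1 : 2 / α < 1 := by rwa [div_lt_one (by linarith)]
  have hm := measurable_clusterPower (α := α) (Pd := Pd) (s := s) hk
  have h1 : ∀ x, 1 - ∫⁻ m, expNeg (clusterPower α Pd s k (x, m)) ∂(markLaw σ) =
      ∫⁻ m, (1 - expNeg (clusterPower α Pd s k (x, m))) ∂(markLaw σ) := by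
    intro x
    rw [lintegral_sub (g := fun m => expNeg (clusterPower α Pd s k (x, m)))
      (measurable_expNeg.comp (hm.comp measurable_prodMk_left))]
    · simp
    · exact ne_top_of_le_ne_top ENNReal.one_ne_top (lintegral_expNeg_le_one _ _)
    · exact .of_forall fun m => expNeg_le_one _
  have h2 : ∀ y t, 0 < t → ∫⁻ x, (1 - expNeg (clusterPower α Pd s k (x, (y, t)))) =
      ENNReal.ofReal (Real.pi * (s * Pd) ^ (2 / α)) * ENNReal.ofReal (Real.Gamma (1 - 2 / α)) *
        ENNReal.ofReal (t ^ (2 / α)) := by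
    intro y t ht
    have h3 := lintegral_add_right_eq_self (μ := (volume : Measure Plane))
      (fun z => 1 - expNeg (ENNReal.ofReal (s * Pd * t * ‖z‖ ^ (-α)))) (k y)
    rw [lintegral_one_sub_expNeg_mul_norm_rpow hα (by positivity),
      Real.mul_rpow (by positivity) ht.le, ← mul_assoc,
      ENNReal.ofReal_mul (p := Real.pi * _) (by positivity)] at h3
    rw [mul_right_comm, ← h3]
    refine lintegral_congr fun x => ?_
    simp only [clusterPower]
    ring_nf
  simp_rw [h1]
  have hm1 : Measurable fun p : Plane × (Plane × ℝ) => 1 - expNeg (clusterPower α Pd s k p) :=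
    measurable_const.sub (measurable_expNeg.comp hm)
  rw [lintegral_lintegral_swap hm1.aemeasurable, markLaw,
    lintegral_prod _ hm1.lintegral_prod_left'.aemeasurable]
  have h4 : ∀ y, ∫⁻ t, (∫⁻ x, (1 - expNeg (clusterPower α Pd s k (x, (y, t))))) ∂(expMeasure 1) =
      ENNReal.ofReal (Real.pi * (s * Pd) ^ (2 / α)) * ENNReal.ofReal (Real.Gamma (1 - 2 / α)) *
        ENNReal.ofReal (Real.Gamma (1 + 2 / α)) := by
    intro y
    rw [lintegral_congr_ae (ae_expMeasure_pos.mono (h2 y)), lintegral_const_mul _ (by fun_prop),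
      lintegral_rpow_expMeasure (by linarith)]
  simp_rw [h4]
  have hG1 := Real.Gamma_pos_of_pos (show 0 < 1 + 2 / α by linarith)
  have hG2 := Real.Gamma_pos_of_pos (show 0 < 1 - 2 / α by linarith)
  rw [lintegral_const, measure_univ, mul_one, ← ENNReal.ofReal_mul (by positivity),
    ← ENNReal.ofReal_mul (by positivity)]
  congr 1
  ring

end D2D
end

/-! ### Palm expectation, almost sure convergence, Laplace transforms -/

section
namespace D2D

open Filter Topology

variable {Ω : Type*} [MeasurableSpace Ω] {P : Measure Ω} {lam σ α Pd s : ℝ}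
  {X Y : ℕ → Ω → Plane} {g : ℕ → Ω → ℝ}

/-- The Mecke formula with `f = 1_B exp h`: at a point in `B`, `f` cancels that point's own factor
and leaves the product over the others. The cancellation needs `h` finite. -/
lemma tsum_setLIntegral_expNeg_tsum_compl [IsProbabilityMeasure P]
    (hX : IsPoissonPointProcess lam X P) (hlam : 0 ≤ lam) {h : Plane → ℝ≥0∞} (hh : Measurable h)
    (hfin : ∀ x, h x ≠ ∞) {B : Set Plane} (hB : MeasurableSet B) :
    ∑' i, ∫⁻ ω in X i ⁻¹' B, expNeg (∑' j : ({i}ᶜ : Set ℕ), h (X j ω)) ∂P =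
      expNeg (∫⁻ x, (1 - expNeg (h x)) ∂(ENNReal.ofReal lam • volume : Measure Plane)) *
        (ENNReal.ofReal lam • volume : Measure Plane) B := by
  let f : Plane → ℝ≥0∞ := B.indicator fun x => (expNeg (h x))⁻¹
  have hf : Measurable f := (measurable_expNeg.comp hh).inv.indicator hB
  have hcancel : ∀ x, expNeg (h x) * (expNeg (h x))⁻¹ = 1 := fun x =>
    ENNReal.mul_inv_cancel (expNeg_eq_zero_iff.not.mpr (hfin x)) (expNeg_ne_top _)
  have hone : ∫⁻ x, expNeg (h x) * f x ∂(ENNReal.ofReal lam • volume : Measure Plane) =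
      (ENNReal.ofReal lam • volume : Measure Plane) B := by
    rw [← lintegral_indicator_one hB]
    refine lintegral_congr fun x => ?_
    by_cases hx : x ∈ B <;> simp [f, hx, hcancel]
  have mH : Measurable fun ω => expNeg (∑' i, h (X i ω)) :=
    measurable_expNeg.comp (measurable_tsum_comp hX.measurable hh)
  rw [← hone, ← lintegral_expNeg_tsum_mul_tsum hX hlam hh hf]
  simp_rw [← ENNReal.tsum_mul_left]
  rw [lintegral_tsum (f := fun i ω => expNeg (∑' j, h (X j ω)) * f (X i ω))
    fun i => (mH.mul (hf.comp (hX.measurable i))).aemeasurable]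
  refine tsum_congr fun i => ?_
  rw [← lintegral_indicator (hX.measurable i hB)]
  refine lintegral_congr fun ω => ?_
  by_cases hx : X i ω ∈ B
  · have hsplit : ∑' j, h (X j ω) = h (X i ω) + ∑' j : ({i}ᶜ : Set ℕ), h (X j ω) := by
      rw [← ENNReal.summable.tsum_add_tsum_compl (s := {i}) ENNReal.summable,
        tsum_singleton i fun j => h (X j ω)]
    rw [Set.indicator_of_mem (s := X i ⁻¹' B) hx,
      show f (X i ω) = _ from Set.indicator_of_mem hx _, hsplit, expNeg_add,
      mul_right_comm, hcancel, one_mul]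
  · simp [f, hx]

/-- The case `h = 0` of the reduced Palm identity. -/
lemma intensityMeasure_eq [IsProbabilityMeasure P] (hX : IsPoissonPointProcess lam X P)
    (hlam : 0 ≤ lam) : intensityMeasure X P = ENNReal.ofReal lam • volume := by
  ext B hB
  have h1 := tsum_setLIntegral_expNeg_tsum_compl hX hlam (h := fun _ => 0) measurable_const
    (by simp) hB
  simp only [tsum_zero, expNeg_zero, lintegral_one, Measure.restrict_apply_univ, tsub_self,
    lintegral_zero, one_mul] at h1
  rw [← h1, intensityMeasure, Measure.sum_apply _ hB]
  exact tsum_congr fun i => Measure.map_apply (hX.measurable i) hB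

lemma expNeg_lintegral_markExponent [IsProbabilityMeasure (gaussianDisplacement σ)]
    (hlam : 0 ≤ lam) (hα : 2 < α) (hPd : 0 < Pd) (hs : 0 ≤ s) {k : Plane → Plane}
    (hk : Measurable k) :
    expNeg (∫⁻ x, (1 - expNeg (markExponent σ (clusterPower α Pd s k) x))
      ∂(ENNReal.ofReal lam • volume : Measure Plane)) =
      ENNReal.ofReal (laplaceFormula lam α Pd s) := by
  have : IsProbabilityMeasure (markLaw σ) := by rw [markLaw]; infer_instance
  have hα1 : 2 / α < 1 := by rwa [div_lt_one (by linarith)]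
  have hG1 := Real.Gamma_pos_of_pos (show 0 < 1 + 2 / α by positivity)
  have hG2 := Real.Gamma_pos_of_pos (show 0 < 1 - 2 / α by linarith)
  simp_rw [expNeg_markExponent]
  rw [lintegral_smul_measure, lintegral_one_sub_lintegral_expNeg_clusterPower hα hPd hs hk,
    smul_eq_mul, ← ENNReal.ofReal_mul hlam, expNeg_ofReal (by positivity), laplaceFormula]
  congr 3
  ring

lemma IsClusterNetwork.lintegral_expNeg_tsum_clusterPower [IsProbabilityMeasure P]
    (hnet : IsClusterNetwork lam σ X Y g P) (hlam : 0 ≤ lam) (hα : 2 < α) (hPd : 0 < Pd)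
    (hs : 0 ≤ s) {k : Plane → Plane} (hk : Measurable k) :
    ∫⁻ ω, expNeg (∑' j, clusterPower α Pd s k (X j ω, (Y j ω, g j ω))) ∂P =
      ENNReal.ofReal (laplaceFormula lam α Pd s) := by
  have := hnet.isProbabilityMeasure_gaussianDisplacement
  have := hnet.isProbabilityMeasure_markLaw
  have hw := measurable_clusterPower (α := α) (Pd := Pd) (s := s) hk
  have h1 := hnet.setLIntegral_expNeg_tsum_marks hw (expNeg_markExponent _) 0
    MeasurableSet.univ Set.univ
  simp only [Set.preimage_univ, Measure.restrict_univ] at h1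
  have h2 : ∀ ω, ∑' j : (Set.univ : Set ℕ), clusterPower α Pd s k (X j ω, (Y j ω, g j ω)) =
      ∑' j, clusterPower α Pd s k (X j ω, (Y j ω, g j ω)) := fun ω =>
    tsum_univ fun j => clusterPower α Pd s k (X j ω, (Y j ω, g j ω))
  have h3 : ∀ ω, ∑' j : (Set.univ : Set ℕ), markExponent σ (clusterPower α Pd s k) (X j ω) =
      ∑' j, markExponent σ (clusterPower α Pd s k) (X j ω) := fun ω =>
    tsum_univ fun j => markExponent σ (clusterPower α Pd s k) (X j ω)
  simp_rw [h2, h3] at h1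
  rw [h1, lintegral_expNeg_tsum hnet.parents hlam (measurable_markExponent hw),
    expNeg_lintegral_markExponent hlam hα hPd hs hk]

lemma IsClusterNetwork.tsum_setLIntegral_expNeg_tsum_clusterPower [IsProbabilityMeasure P]
    (hnet : IsClusterNetwork lam σ X Y g P) (hlam : 0 ≤ lam) (hα : 2 < α) (hPd : 0 < Pd)
    (hs : 0 ≤ s) {k : Plane → Plane} (hk : Measurable k) {B : Set Plane} (hB : MeasurableSet B) :
    ∑' i, ∫⁻ ω in X i ⁻¹' B, expNeg (∑' j : ({i}ᶜ : Set ℕ),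
      clusterPower α Pd s k (X j ω, (Y j ω, g j ω))) ∂P =
      ENNReal.ofReal (laplaceFormula lam α Pd s) * intensityMeasure X P B := by
  have := hnet.isProbabilityMeasure_gaussianDisplacement
  have := hnet.isProbabilityMeasure_markLaw
  have hw := measurable_clusterPower (α := α) (Pd := Pd) (s := s) hk
  simp_rw [hnet.setLIntegral_expNeg_tsum_marks hw (expNeg_markExponent _) _ hB]
  rw [tsum_setLIntegral_expNeg_tsum_compl hnet.parents hlam (measurable_markExponent hw) _ hB,
    expNeg_lintegral_markExponent hlam hα hPd hs hk, intensityMeasure_eq hnet.parents hlam]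
  -- The exponent is finite: `clusterPower` is never `∞`, so the integrand defining `v x` is
  -- positive everywhere and its integral is not `0`.
  intro x
  rw [Ne, ← expNeg_eq_zero_iff, expNeg_markExponent, lintegral_eq_zero_iff
    (f := fun m => expNeg (clusterPower α Pd s k (x, m)))
    (measurable_expNeg.comp (hw.comp measurable_prodMk_left))]
  intro h0
  obtain ⟨m, hm⟩ := h0.exists
  exact ENNReal.ofReal_ne_top (expNeg_eq_zero_iff.mp hm)

lemma tendsto_laplaceFormula (hα : 2 < α) :
    Tendsto (fun n : ℕ => laplaceFormula lam α Pd (1 / ((n : ℝ) + 1))) atTop (𝓝 1) := by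
  have hα0 : 0 < 2 / α := by positivity
  have h1 : Continuous fun s => laplaceFormula lam α Pd s := by
    unfold laplaceFormula
    have : Continuous fun s : ℝ => (s * Pd) ^ (2 / α) :=
      (Real.continuous_rpow_const hα0.le).comp (continuous_mul_const Pd)
    fun_prop
  have h2 : laplaceFormula lam α Pd 0 = 1 := by
    simp [laplaceFormula, Real.zero_rpow hα0.ne']
  have h3 := (h1.tendsto 0).comp tendsto_one_div_add_atTop_nhds_zero_nat
  rwa [h2] at h3

lemma clusterPower_eq_mul (hs : 0 ≤ s) (k : Plane → Plane) (p : Plane × (Plane × ℝ)) :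
    clusterPower α Pd s k p = ENNReal.ofReal s * clusterPower α Pd 1 k p := by
  rw [clusterPower, clusterPower, one_mul, ENNReal.ofReal_mul hs]

/-- For `s > 0` the variable `exp (-s I)` vanishes where `I = ∞`, so the transform at `s` is at most
`P (I < ∞)`. It tends to `1` along `s = 1 / (n + 1)`. -/
lemma IsClusterNetwork.ae_tsum_clusterPower_ne_top [IsProbabilityMeasure P]
    (hnet : IsClusterNetwork lam σ X Y g P) (hlam : 0 ≤ lam) (hα : 2 < α) (hPd : 0 < Pd)
    {k : Plane → Plane} (hk : Measurable k) :
    ∀ᵐ ω ∂P, ∑' j, clusterPower α Pd 1 k (X j ω, (Y j ω, g j ω)) ≠ ∞ := by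
  have hm : Measurable fun ω => ∑' j, clusterPower α Pd 1 k (X j ω, (Y j ω, g j ω)) :=
    Measurable.tsum fun j => (measurable_clusterPower hk).comp
      ((hnet.parents.measurable j).prodMk
        ((hnet.measurable_displacement j).prodMk (hnet.measurable_fading j)))
  let E : Set Ω := {ω | ∑' j, clusterPower α Pd 1 k (X j ω, (Y j ω, g j ω)) ≠ ∞}
  have hE : MeasurableSet E := (measurableSet_singleton ∞).compl.preimage hm
  have hle : ∀ n : ℕ, ENNReal.ofReal (laplaceFormula lam α Pd (1 / ((n : ℝ) + 1))) ≤ P E := by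
    intro n
    have hs : 0 < 1 / ((n : ℝ) + 1) := by positivity
    rw [← hnet.lintegral_expNeg_tsum_clusterPower hlam hα hPd hs.le hk,
      ← lintegral_indicator_one hE]
    refine lintegral_mono fun ω => ?_
    by_cases hω : ω ∈ E
    · simpa [hω] using expNeg_le_one _
    · have hω' : ∑' j, clusterPower α Pd 1 k (X j ω, (Y j ω, g j ω)) = ∞ := not_not.mp hω
      simp_rw [clusterPower_eq_mul hs.le]
      rw [ENNReal.tsum_mul_left, hω', ENNReal.mul_top (ENNReal.ofReal_pos.mpr hs).ne', expNeg_top]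
      exact zero_le
  have h1 : 1 ≤ P E := by
    have := (ENNReal.continuous_ofReal.tendsto 1).comp
      (tendsto_laplaceFormula (lam := lam) (Pd := Pd) hα)
    rw [ENNReal.ofReal_one] at this
    exact le_of_tendsto' this hle
  exact (mem_ae_iff_prob_eq_one hE).mpr (le_antisymm prob_le_one h1)

lemma IsClusterNetwork.ae_fading_pos (hnet : IsClusterNetwork lam σ X Y g P) :
    ∀ᵐ ω ∂P, ∀ i, 0 < g i ω := by
  rw [ae_all_iff]
  intro i
  have h := ae_expMeasure_pos
  rw [← (hnet.hasLaw_fading i).map_eq] at h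
  exact ae_of_ae_map (hnet.measurable_fading i).aemeasurable h

/-- Almost surely, the interference converges, and its exponential is given by the sums of
extended nonnegative numbers. -/
lemma IsClusterNetwork.ae_summable_receivedPower [IsProbabilityMeasure P]
    (hnet : IsClusterNetwork lam σ X Y g P) (hlam : 0 ≤ lam) (hα : 2 < α) (hPd : 0 < Pd)
    {k : Plane → Plane} (hk : Measurable k) {T : ℕ → Ω → Plane}
    (hT : ∀ i ω, T i ω = X i ω + k (Y i ω)) :
    ∀ᵐ ω ∂P, Summable (fun i => receivedPower α Pd T g i ω) ∧
      ∀ (S : Set ℕ) (s : ℝ), 0 ≤ s →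
        ENNReal.ofReal (Real.exp (-s * interference α Pd T g S ω)) =
          expNeg (∑' j : S, clusterPower α Pd s k (X j ω, (Y j ω, g j ω))) := by
  filter_upwards [hnet.ae_tsum_clusterPower_ne_top hlam hα hPd hk, hnet.ae_fading_pos]
    with ω hω hg
  have hnonneg : ∀ i, 0 ≤ receivedPower α Pd T g i ω := fun i => by
    have := hg i
    rw [receivedPower]
    positivity
  have hcp : ∀ i s, clusterPower α Pd s k (X i ω, (Y i ω, g i ω)) =
      ENNReal.ofReal (s * receivedPower α Pd T g i ω) := fun i s => by
    rw [clusterPower, receivedPower, hT]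
  have hsum : Summable fun i => receivedPower α Pd T g i ω := by
    refine (ENNReal.summable_toReal hω).congr fun i => ?_
    rw [hcp, one_mul, ENNReal.toReal_ofReal (hnonneg i)]
  refine ⟨hsum, fun S s hs => ?_⟩
  have hS : Summable fun i : S => receivedPower α Pd T g i ω := hsum.subtype S
  simp_rw [hcp]
  rw [← ENNReal.ofReal_tsum_of_nonneg (fun i : S => mul_nonneg hs (hnonneg i)) (hS.mul_left s),
    tsum_mul_left, expNeg_ofReal (mul_nonneg hs (tsum_nonneg fun i : S => hnonneg i)), neg_mul,
    interference]

lemma IsClusterNetwork.integral_exp_neg_mul_interference [IsProbabilityMeasure P]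
    (hnet : IsClusterNetwork lam σ X Y g P) (hlam : 0 ≤ lam) (hα : 2 < α) (hPd : 0 < Pd)
    (hs : 0 ≤ s) {k : Plane → Plane} (hk : Measurable k) {T : ℕ → Ω → Plane}
    (hT : ∀ i ω, T i ω = X i ω + k (Y i ω)) :
    ∫ ω, Real.exp (-s * interference α Pd T g Set.univ ω) ∂P = laplaceFormula lam α Pd s := by
  have hae := hnet.ae_summable_receivedPower hlam hα hPd hk hT
  have hm : AEMeasurable (fun ω => Real.exp (-s * interference α Pd T g Set.univ ω)) P := by
    have hm1 : Measurable fun ω =>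
        (expNeg (∑' j, clusterPower α Pd s k (X j ω, (Y j ω, g j ω)))).toReal :=
      (measurable_expNeg.comp (Measurable.tsum fun j => (measurable_clusterPower hk).comp
        ((hnet.parents.measurable j).prodMk
          ((hnet.measurable_displacement j).prodMk (hnet.measurable_fading j))))).ennreal_toReal
    refine ⟨_, hm1, ?_⟩
    filter_upwards [hae] with ω hω
    have h := hω.2 Set.univ s hs
    rw [tsum_univ fun j => clusterPower α Pd s k (X j ω, (Y j ω, g j ω))] at h
    rw [← h, ENNReal.toReal_ofReal (Real.exp_pos _).le]
  rw [integral_eq_lintegral_of_nonneg_ae (.of_forall fun ω => (Real.exp_pos _).le)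
    hm.aestronglyMeasurable]
  have h1 : ∫⁻ ω, ENNReal.ofReal (Real.exp (-s * interference α Pd T g Set.univ ω)) ∂P =
      ENNReal.ofReal (laplaceFormula lam α Pd s) := by
    rw [← hnet.lintegral_expNeg_tsum_clusterPower hlam hα hPd hs hk]
    refine lintegral_congr_ae ?_
    filter_upwards [hae] with ω hω
    rw [hω.2 Set.univ s hs, tsum_univ fun j => clusterPower α Pd s k (X j ω, (Y j ω, g j ω))]
  rw [h1, laplaceFormula, ENNReal.toReal_ofReal (Real.exp_pos _).le]

end D2D
end

/-- In order: the interference sums converge almost surely; the Laplace transform of the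
interference from all clusters other than the representative one, given that the representative
cluster centre is at `x₀`, is the stated function of `s` whatever `x₀` is; the interference
from all the clusters has the same Laplace transform; and so does the interference when
the transmitters are the points of the Poisson process themselves. -/
theorem lemma1 {Ω : Type*} [MeasurableSpace Ω] (P : Measure Ω) [IsProbabilityMeasure P]
    (lam σ α Pd : ℝ) (hlam : 0 < lam) (hσ : 0 < σ) (hα : 2 < α) (hPd : 0 < Pd)
    (X Y : ℕ → Ω → D2D.Plane) (g : ℕ → Ω → ℝ)
    (hnet : D2D.IsClusterNetwork lam σ X Y g P) :
    (∀ᵐ ω ∂P, Summable (fun i => D2D.receivedPower α Pd (X + Y) g i ω) ∧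
      Summable (fun i => D2D.receivedPower α Pd X g i ω)) ∧
    ∀ s : ℝ, 0 ≤ s →
      D2D.IsPalmExpectation X P
        (fun i ω => ENNReal.ofReal (Real.exp (-s * D2D.interference α Pd (X + Y) g {i}ᶜ ω)))
        (fun _ => ENNReal.ofReal (D2D.laplaceFormula lam α Pd s)) ∧
      ∫ ω, Real.exp (-s * D2D.interference α Pd (X + Y) g Set.univ ω) ∂P =
        D2D.laplaceFormula lam α Pd s ∧
      ∫ ω, Real.exp (-s * D2D.interference α Pd X g Set.univ ω) ∂P =
        D2D.laplaceFormula lam α Pd s := by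
  have hT : ∀ i ω, (X + Y) i ω = X i ω + id (Y i ω) := fun _ _ => rfl
  -- Transmitters at the centres themselves are the case of the zero displacement map.
  have hT0 : ∀ i ω, X i ω = X i ω + (fun _ => 0 : D2D.Plane → D2D.Plane) (Y i ω) :=
    fun i ω => (add_zero (X i ω)).symm
  have hae := hnet.ae_summable_receivedPower hlam.le hα hPd measurable_id hT
  refine ⟨hae.mp <| (hnet.ae_summable_receivedPower hlam.le hα hPd measurable_const hT0).mono
    fun ω h0 h => ⟨h.1, h0.1⟩, fun s hs => ⟨⟨measurable_const, fun B hB => ?_⟩,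
    hnet.integral_exp_neg_mul_interference hlam.le hα hPd hs measurable_id hT,
    hnet.integral_exp_neg_mul_interference hlam.le hα hPd hs measurable_const hT0⟩⟩
  rw [setLIntegral_const, ← hnet.tsum_setLIntegral_expNeg_tsum_clusterPower hlam.le hα hPd hs
    measurable_id hB]
  exact tsum_congr fun i => lintegral_congr_ae <| ae_restrict_of_ae <|
    hae.mono fun ω hω => hω.2 _ s hs
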